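/- Let $\mathcal P_1(\mathbb R)$ be the set of all Borel probability measures $\mu$ on $\mathbb R$ with $\int|x|\,d\mu(x)<\infty$. For $\mu,\nu\in\mathcal P_1(\mathbb R)$ write $\mu\le_{\rm icv}\nu$ (second order stochastic dominance, or increasing concave order) if $\int\min(x-s,0)\,d\mu(x)\le\int\min(x-s,0)\,d\nu(x)$ for all $s\in\mathbb R$, and $\mu\le_{\rm icx}\nu$ (increasing convex order) if $\int\max(x-s,0)\,d\mu(x)\le\int\max(x-s,0)\,d\nu(x)$ for all $s\in\mathbb R$. Both relations are partial orders on $\mathcal P_1(\mathbb R)$. Let $W_1(\mu,\nu)=\inf_\gamma\int|x-y|\,d\gamma(x,y)$ be the Wasserstein-1 distance, where $\gamma$ ranges over the couplings of $\mu$ and $\nu$. A lattice is a partially ordered set in which every finite nonempty subset has a supremum and an infimum. A lattice is called Dedekind super complete if every nonempty subset that is bounded above (respectively, below) has a supremum (respectively, infimum) which is also the supremum (respectively, infimum) of some countable subset of it. (a) $(\mathcal P_1(\mathbb R),\le_{\rm icv})$ and $(\mathcal P_1(\mathbb R),\le_{\rm icx})$ are Dedekind super complete lattices. (b) Let $M\subset\mathcal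 P_1(\mathbb R)$ be nonempty, bounded below with respect to $\le_{\rm icv}$ and bounded above with respect to $\le_{\rm icx}$, and let $\preceq$ be either one of $\le_{\rm icv}$ and $\le_{\rm icx}$. If $M$ is directed upwards with respect to $\preceq$ (any two elements of $M$ have an upper bound in $M$), then the supremum $\mu$ of $M$ with respect to $\preceq$ exists in $\mathcal P_1(\mathbb R)$, and there is a $\preceq$-nondecreasing sequence $(\mu^n)_{n\in\mathbb N}$ in $M$ with $W_1(\mu^n,\mu)\to0$. If $M$ is directed downwards with respect to $\preceq$ (any two elements of $M$ have a lower bound in $M$), then the infimum $\mu$ of $M$ with respect to $\preceq$ exists in $\mathcal P_1(\mathbb R)$, and there is a $\preceq$-nonincreasing sequence $(\mu^n)_{n\in\mathbb N}$ in $M$ with $W_1(\mu^n,\mu)\to0$. -/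

import Mathlib

open MeasureTheory Filter Topology
open scoped ENNReal

/-- `𝒫₁(ℝ)`: Borel probability measures on `ℝ` with finite first moment. -/
def P₁ : Type :=
  {μ : Measure ℝ // IsProbabilityMeasure μ ∧ Integrable (fun x : ℝ => x) μ}

namespace P₁

/-- The underlying Borel measure. -/
def meas (μ : P₁) : Measure ℝ := μ.1

instance (μ : P₁) : IsProbabilityMeasure μ.meas := μ.2.1

theorem integrable_id (μ : P₁) : Integrable (fun x : ℝ => x) μ.meas := μ.2.2

/-- The (negative) integrated distribution function
`μ_{1,-}(s) = ∫ (x - s)⁻ dμ(x) = - ∫_{-∞}^s μ((-∞, u]) du`, where `y⁻ = min y 0`. -/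
noncomputable def intDist (μ : P₁) (s : ℝ) : ℝ := ∫ x, min (x - s) 0 ∂μ.meas

/-- The integrated survival function
`μ_{1,+}(s) = ∫ (x - s)⁺ dμ(x) = ∫_s^∞ μ((u, ∞)) du`, where `y⁺ = max y 0`. -/
noncomputable def intSurv (μ : P₁) (s : ℝ) : ℝ := ∫ x, max (x - s) 0 ∂μ.meas

theorem integrable_sub (μ : P₁) (s : ℝ) : Integrable (fun x : ℝ => x - s) μ.meas :=
  μ.integrable_id.sub (integrable_const s)

theorem integrable_max (μ : P₁) (s : ℝ) : Integrable (fun x : ℝ => max (x - s) 0) μ.meas :=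
  (μ.integrable_sub s).pos_part

theorem integrable_min (μ : P₁) (s : ℝ) : Integrable (fun x : ℝ => min (x - s) 0) μ.meas :=
  (μ.integrable_sub s).inf (integrable_zero ℝ ℝ μ.meas)

theorem intDist_add_intSurv (μ : P₁) (s : ℝ) :
    μ.intDist s + μ.intSurv s = (∫ x, x ∂μ.meas) - s := by
  unfold intDist intSurv
  rw [← integral_add (μ.integrable_min s) (μ.integrable_max s)]
  have h : ∀ x : ℝ, min (x - s) 0 + max (x - s) 0 = x - s := fun x => by
    rw [min_add_max, add_zero]
  simp only [h]
  rw [integral_sub μ.integrable_id (integrable_const s)]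
  simp

/-- Minus the right derivative of the integrated survival function is the survival function. -/
theorem tendsto_slope_intSurv (μ : P₁) (s : ℝ) :
    Tendsto (fun n : ℕ => ((n : ℝ) + 1) * (μ.intSurv s - μ.intSurv (s + 1 / ((n : ℝ) + 1))))
      atTop (𝓝 (μ.meas.real (Set.Ioi s))) := by
  have key : ∀ n : ℕ, ((n : ℝ) + 1) * (μ.intSurv s - μ.intSurv (s + 1 / ((n : ℝ) + 1)))
      = ∫ x, ((n : ℝ) + 1) * (max (x - s) 0 - max (x - (s + 1 / ((n : ℝ) + 1))) 0) ∂μ.meas := by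
    intro n
    unfold intSurv
    rw [integral_const_mul, integral_sub (μ.integrable_max _) (μ.integrable_max _)]
  have hind : μ.meas.real (Set.Ioi s) = ∫ x, (Set.Ioi s).indicator (fun _ => (1 : ℝ)) x ∂μ.meas := by
    rw [integral_indicator_const _ measurableSet_Ioi]; simp
  simp only [key]
  rw [hind]
  refine tendsto_integral_of_dominated_convergence (fun _ => 1) ?_ (integrable_const _) ?_ ?_
  · intro n
    exact (((μ.integrable_max _).sub (μ.integrable_max _)).const_mul _).aestronglyMeasurable
  · intro n
    refine Eventually.of_forall fun x => ?_
    have hn : (0 : ℝ) < (n : ℝ) + 1 := by positivity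
    have he : 0 < 1 / ((n : ℝ) + 1) := by positivity
    have hm : ((n : ℝ) + 1) * (1 / ((n : ℝ) + 1)) = 1 := by field_simp
    have h0 : 0 ≤ max (x - s) 0 - max (x - (s + 1 / ((n : ℝ) + 1))) 0 :=
      sub_nonneg.2 (max_le_max (by linarith) le_rfl)
    have h1 : max (x - s) 0 - max (x - (s + 1 / ((n : ℝ) + 1))) 0 ≤ 1 / ((n : ℝ) + 1) := by
      rcases max_cases (x - s) 0 with h | h <;>
        rcases max_cases (x - (s + 1 / ((n : ℝ) + 1))) 0 with h' | h' <;> linarith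
    rw [Real.norm_eq_abs, abs_of_nonneg (mul_nonneg hn.le h0)]
    exact (mul_le_mul_of_nonneg_left h1 hn.le).trans_eq hm
  · refine Eventually.of_forall fun x => ?_
    by_cases hx : s < x
    · rw [Set.indicator_of_mem (Set.mem_Ioi.2 hx)]
      refine tendsto_const_nhds.congr' ?_
      have hev : ∀ᶠ n : ℕ in atTop, 1 / ((n : ℝ) + 1) < x - s :=
        tendsto_one_div_add_atTop_nhds_zero_nat.eventually_lt_const (by linarith)
      filter_upwards [hev] with n hn
      rw [max_eq_left (by linarith), max_eq_left (by linarith)]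
      have : (n : ℝ) + 1 ≠ 0 := by positivity
      field_simp
      ring
    · rw [Set.indicator_of_notMem (by simpa using hx)]
      refine tendsto_const_nhds.congr fun n => ?_
      have he : 0 < 1 / ((n : ℝ) + 1) := by positivity
      rw [max_eq_right (by linarith), max_eq_right (by linarith)]
      ring

theorem eq_of_intSurv_sub {μ ν : P₁}
    (h : ∀ s t, μ.intSurv s - μ.intSurv t = ν.intSurv s - ν.intSurv t) : μ = ν := by
  have hreal : ∀ s, μ.meas.real (Set.Ioi s) = ν.meas.real (Set.Ioi s) := fun s =>
    tendsto_nhds_unique (μ.tendsto_slope_intSurv s)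
      ((ν.tendsto_slope_intSurv s).congr fun n => by rw [h])
  have hm : μ.meas = ν.meas := by
    refine Measure.ext_of_Ici _ _ fun a => ?_
    have hIoi : ∀ ρ : P₁, Tendsto (fun n : ℕ => ρ.meas (Set.Ioi (a - 1 / ((n : ℝ) + 1)))) atTop
        (𝓝 (ρ.meas (Set.Ici a))) := by
      intro ρ
      have hset : Set.Ici a = ⋂ n : ℕ, Set.Ioi (a - 1 / ((n : ℝ) + 1)) := by
        ext x
        simp only [Set.mem_Ici, Set.mem_iInter, Set.mem_Ioi]
        constructor
        · intro hx n
          have : 0 < 1 / ((n : ℝ) + 1) := by positivity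
          linarith
        · intro hx
          refine le_of_tendsto' (f := fun n : ℕ => a - 1 / ((n : ℝ) + 1)) (x := atTop) ?_
            fun n => (hx n).le
          simpa using tendsto_const_nhds.sub
            (tendsto_one_div_add_atTop_nhds_zero_nat (𝕜 := ℝ))
      rw [hset]
      refine tendsto_measure_iInter_atTop (fun n => measurableSet_Ioi.nullMeasurableSet) ?_
        ⟨0, measure_ne_top _ _⟩
      intro m n hmn
      refine Set.Ioi_subset_Ioi ?_
      have := one_div_le_one_div_of_le (α := ℝ) (a := (m : ℝ) + 1) (b := (n : ℝ) + 1)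
        (by positivity) (by exact_mod_cast Nat.succ_le_succ hmn)
      linarith
    refine tendsto_nhds_unique (hIoi μ) ((hIoi ν).congr fun n => ?_)
    have := hreal (a - 1 / ((n : ℝ) + 1))
    exact ((measureReal_eq_measureReal_iff).1 this).symm
  exact Subtype.ext hm

/-- The increasing concave order (second order stochastic dominance) on `𝒫₁(ℝ)`:
`μ ≤_icv ν` iff `μ_{1,-}(s) ≤ ν_{1,-}(s)` for all `s`. -/
@[reducible] def icv : PartialOrder P₁ where
  le μ ν := ∀ s, μ.intDist s ≤ ν.intDist s
  le_refl _ _ := le_rfl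
  le_trans _ _ _ h₁ h₂ s := (h₁ s).trans (h₂ s)
  le_antisymm μ ν h₁ h₂ := by
    refine eq_of_intSurv_sub fun s t => ?_
    have hs := le_antisymm (h₁ s) (h₂ s)
    have ht := le_antisymm (h₁ t) (h₂ t)
    linarith [μ.intDist_add_intSurv s, μ.intDist_add_intSurv t, ν.intDist_add_intSurv s,
      ν.intDist_add_intSurv t]

/-- The increasing convex order on `𝒫₁(ℝ)`:
`μ ≤_icx ν` iff `μ_{1,+}(s) ≤ ν_{1,+}(s)` for all `s`. -/
@[reducible] def icx : PartialOrder P₁ where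
  le μ ν := ∀ s, μ.intSurv s ≤ ν.intSurv s
  le_refl _ _ := le_rfl
  le_trans _ _ _ h₁ h₂ s := (h₁ s).trans (h₂ s)
  le_antisymm μ ν h₁ h₂ := by
    refine eq_of_intSurv_sub fun s t => ?_
    rw [le_antisymm (h₁ s) (h₂ s), le_antisymm (h₁ t) (h₂ t)]

/-- The couplings (transport plans) of `μ` and `ν`: measures on `ℝ × ℝ` with marginals
`μ` and `ν`. -/
def couplings (μ ν : P₁) : Set (Measure (ℝ × ℝ)) :=
  {γ | γ.map Prod.fst = μ.meas ∧ γ.map Prod.snd = ν.meas}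

/-- The Wasserstein-1 distance `W₁(μ, ν) = inf_γ ∫ |x - y| dγ(x, y)`, over all couplings `γ`. -/
noncomputable def W₁ (μ ν : P₁) : ℝ≥0∞ :=
  ⨅ γ ∈ couplings μ ν, ∫⁻ z, ENNReal.ofReal |z.1 - z.2| ∂γ

/-- Convergence of a sequence in the Wasserstein-1 topology. -/
def TendstoW₁ (u : ℕ → P₁) (μ : P₁) : Prop :=
  Tendsto (fun n => W₁ (u n) μ) atTop (𝓝 0)

end P₁

/-- `(L, ≤)` is a lattice: every finite nonempty subset has a least upper bound and a greatest
lower bound. -/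
def IsLatticeOrder (L : Type*) [PartialOrder L] : Prop :=
  ∀ A : Set L, A.Finite → A.Nonempty → (∃ x, IsLUB A x) ∧ (∃ x, IsGLB A x)

/-- `(L, ≤)` is a Dedekind super complete lattice: it is a lattice in which every nonempty subset
that is bounded above (below) has a least upper bound (greatest lower bound), and this is also the
least upper bound (greatest lower bound) of some countable subset of it. -/
structure IsDedekindSuperComplete (L : Type*) [PartialOrder L] : Prop where
  isLattice : IsLatticeOrder L
  exists_isLUB : ∀ M : Set L, M.Nonempty → BddAbove M →
    ∃ x, IsLUB M x ∧ ∃ C ⊆ M, C.Countable ∧ IsLUB C x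
  exists_isGLB : ∀ M : Set L, M.Nonempty → BddBelow M →
    ∃ x, IsGLB M x ∧ ∃ C ⊆ M, C.Countable ∧ IsGLB C x

/-! Sending `μ` to its integrated survival function turns `icx` into the pointwise order on an
explicit class of functions: convex, nonincreasing, tending to `0` at `+∞`, with `f s + s`
nondecreasing and bounded below (`exists_intSurv_eq`). Pointwise suprema stay in this class as soon
as some function vanishing at `+∞` dominates them; infima are suprema of the sets of lower bounds.
Countable subsets suffice because these functions are continuous, hence determined on the rationals,
and `ℚ → ℝ` is separable.

For a directed set, a monotone sequence that overtakes such a countable subset converges pointwise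
to the extremum. The `icx` upper bound controls the right tails and the `icv` lower bound the left
tails, so the limit lies in the class and the means converge. Pointwise convergence of these convex
functions gives convergence of their derivatives, the survival functions, almost everywhere.
Scheffé's lemma upgrades this to `L¹` convergence of the distribution functions, and the quantile
coupling bounds `W₁` by that `L¹` distance.

The reflection `x ↦ -x` is an order-reversing bijection exchanging `icv` and `icx`, so everything
about `icv` follows from `icx`. -/

/-- **Scheffé's lemma** for nonnegative integrable functions. -/
theorem tendsto_integral_abs_sub_of_tendsto_integral {α : Type*} [MeasurableSpace α]
    {m : Measure α} {f : ℕ → α → ℝ} {g : α → ℝ} (hf : ∀ n, Integrable (f n) m)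
    (hg : Integrable g m) (hf0 : ∀ n x, 0 ≤ f n x) (hg0 : ∀ x, 0 ≤ g x)
    (hlim : ∀ᵐ x ∂m, Tendsto (fun n => f n x) atTop (𝓝 (g x)))
    (hint : Tendsto (fun n => ∫ x, f n x ∂m) atTop (𝓝 (∫ x, g x ∂m))) :
    Tendsto (fun n => ∫ x, |f n x - g x| ∂m) atTop (𝓝 0) := by
  have hpos : ∀ n, Integrable (fun x => max (g x - f n x) 0) m := fun n =>
    (hg.sub (hf n)).pos_part
  -- The positive part of `g - f n` is dominated by `g` because `f n ≥ 0`; the rest follows from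
  -- `|y| = 2 * max y 0 - y` with `y = g - f n`.
  have h1 : Tendsto (fun n => ∫ x, max (g x - f n x) 0 ∂m) atTop (𝓝 (∫ _, (0 : ℝ) ∂m)) := by
    refine tendsto_integral_of_dominated_convergence g (fun n => (hpos n).aestronglyMeasurable)
      hg (fun n => ae_of_all _ fun x => ?_) ?_
    · rw [Real.norm_eq_abs, abs_of_nonneg (le_max_right _ _)]
      exact max_le (by linarith [hf0 n x]) (hg0 x)
    · filter_upwards [hlim] with x hx
      have : Tendsto (fun n => max (g x - f n x) 0) atTop (𝓝 (max (g x - g x) 0)) :=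
        (tendsto_const_nhds.sub hx).max tendsto_const_nhds
      simpa using this
  have h2 : ∀ n, ∫ x, |f n x - g x| ∂m
      = 2 * (∫ x, max (g x - f n x) 0 ∂m) - ((∫ x, g x ∂m) - ∫ x, f n x ∂m) := by
    intro n
    rw [← integral_const_mul, ← integral_sub hg (hf n),
      ← integral_sub ((hpos n).const_mul 2) (by exact hg.sub (hf n))]
    refine integral_congr_ae (ae_of_all _ fun x => ?_)
    rcases le_total (g x) (f n x) with h | h
    · simp only [abs_of_nonneg (sub_nonneg.2 h), max_eq_right (sub_nonpos.2 h)]; simp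
    · simp only [abs_of_nonpos (sub_nonpos.2 h), max_eq_left (sub_nonneg.2 h)]; simp; ring
  simp only [h2]
  have := (h1.const_mul 2).sub (tendsto_const_nhds (x := ∫ x, g x ∂m).sub hint)
  simpa using this

/-- Layer cake formula for the positive part of `x - s`. -/
theorem lintegral_ofReal_max_sub (m : Measure ℝ) (s : ℝ) :
    ∫⁻ x, ENNReal.ofReal (max (x - s) 0) ∂m = ∫⁻ u in Set.Ioi s, m (Set.Ioi u) := by
  rw [lintegral_eq_lintegral_meas_lt (f := fun x => max (x - s) 0) m
    (ae_of_all _ fun x => le_max_right _ _)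
    (by fun_prop : Measurable fun x : ℝ => max (x - s) 0).aemeasurable]
  have hmp : MeasurePreserving (fun t : ℝ => t + s) volume volume :=
    measurePreserving_add_right volume s
  have := hmp.setLIntegral_comp_preimage_emb (measurableEmbedding_addRight s)
    (fun u => m (Set.Ioi u)) (Set.Ioi s)
  rw [← this]
  have hpre : (fun t : ℝ => t + s) ⁻¹' Set.Ioi s = Set.Ioi 0 := by ext; simp
  rw [hpre]
  refine setLIntegral_congr_fun measurableSet_Ioi fun t ht => ?_
  congr 1
  ext x
  have ht : 0 < t := ht
  simp only [Set.mem_ofPred_eq, Set.mem_Ioi, lt_max_iff]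
  constructor
  · rintro (h | h) <;> linarith
  · intro h; left; linarith

/-- Layer cake formula for the negative part of `x - s`. -/
theorem lintegral_ofReal_neg_min_sub (m : Measure ℝ) (s : ℝ) :
    ∫⁻ x, ENNReal.ofReal (-min (x - s) 0) ∂m = ∫⁻ u in Set.Iio s, m (Set.Iic u) := by
  rw [lintegral_eq_lintegral_meas_le (f := fun x => -min (x - s) 0) m
    (ae_of_all _ fun x => neg_nonneg.2 (min_le_right _ _))
    (by fun_prop : Measurable fun x : ℝ => -min (x - s) 0).aemeasurable]
  have hmp : MeasurePreserving (fun t : ℝ => s - t) volume volume :=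
    Measure.measurePreserving_sub_left volume s
  have := hmp.setLIntegral_comp_preimage_emb (MeasurableEquiv.subLeft s).measurableEmbedding
    (fun u => m (Set.Iic u)) (Set.Iio s)
  rw [← this]
  have hpre : (fun t : ℝ => s - t) ⁻¹' Set.Iio s = Set.Ioi 0 := by ext; simp
  rw [hpre]
  refine setLIntegral_congr_fun measurableSet_Ioi fun t ht => ?_
  congr 1
  ext x
  have ht : 0 < t := ht
  simp only [Set.mem_ofPred_eq, Set.mem_Iic, le_neg, min_le_iff]
  constructor
  · rintro (h | h) <;> linarith
  · intro h; left; linarith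

/-! ### Quantile coupling and the bound on `W₁` -/

/-- For the quantile function of a probability measure on `ℝ`, we have the Galois connection
`Q u ≤ t ↔ u ≤ F t`. -/
theorem exists_quantile (m : Measure ℝ) [IsProbabilityMeasure m] :
    ∃ Q : ℝ → ℝ, ∀ u ∈ Set.Ioo (0 : ℝ) 1, ∀ t, Q u ≤ t ↔ u ≤ m.real (Set.Iic t) := by
  refine ⟨fun u => sInf {t | u ≤ m.real (Set.Iic t)}, fun u hu t => ?_⟩
  simp only [← ProbabilityTheory.cdf_eq_real]
  set F := ProbabilityTheory.cdf m
  have hne : {t | u ≤ F t}.Nonempty := by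
    obtain ⟨t, ht⟩ := ((ProbabilityTheory.tendsto_cdf_atTop m).eventually_const_lt hu.2).exists
    exact ⟨t, ht.le⟩
  have hbdd : BddBelow {t | u ≤ F t} := by
    obtain ⟨t, ht⟩ := ((ProbabilityTheory.tendsto_cdf_atBot m).eventually_lt_const hu.1).exists
    refine ⟨t, fun r hr => ?_⟩
    by_contra! h
    exact absurd ((hr : u ≤ F r).trans (F.mono h.le)) (not_le.2 ht)
  constructor
  · intro h
    refine le_trans ?_ (F.mono h)
    -- The infimum is attained: every `r` to its right satisfies `u ≤ F r`, and `F` is right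
    -- continuous.
    have hc : Tendsto F (𝓝[>] (sInf {t | u ≤ F t})) (𝓝 (F (sInf {t | u ≤ F t}))) :=
      (F.right_continuous _).mono Set.Ioi_subset_Ici_self
    refine ge_of_tendsto hc ?_
    filter_upwards [self_mem_nhdsWithin] with r hr
    obtain ⟨r', hr', hlt⟩ := exists_lt_of_csInf_lt hne hr
    exact (hr' : u ≤ F r').trans (F.mono hlt.le)
  · intro h
    exact csInf_le hbdd h

namespace P₁

/-- By the Galois connection, the preimage of `Iic t` in `(0, 1)` is the set of `u ≤ F t`, which has
length `F t`. -/
theorem map_quantile {m : Measure ℝ} [IsProbabilityMeasure m] {Q : ℝ → ℝ}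
    (hQ : ∀ u ∈ Set.Ioo (0 : ℝ) 1, ∀ t, Q u ≤ t ↔ u ≤ m.real (Set.Iic t)) :
    AEMeasurable Q (volume.restrict (Set.Ioo 0 1)) ∧
      (volume.restrict (Set.Ioo 0 1)).map Q = m := by
  have hmeas : AEMeasurable Q (volume.restrict (Set.Ioo 0 1)) := by
    refine aemeasurable_restrict_of_monotoneOn measurableSet_Ioo fun u hu v hv huv => ?_
    exact (hQ u hu _).2 (huv.trans ((hQ v hv _).1 le_rfl))
  refine ⟨hmeas, ?_⟩
  have : IsFiniteMeasure ((volume.restrict (Set.Ioo (0 : ℝ) 1)).map Q) := inferInstance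
  refine Measure.ext_of_Iic _ _ fun t => ?_
  rw [Measure.map_apply_of_aemeasurable hmeas measurableSet_Iic,
    Measure.restrict_apply' measurableSet_Ioo]
  have hset : Q ⁻¹' Set.Iic t ∩ Set.Ioo 0 1 = Set.Iic (m.real (Set.Iic t)) ∩ Set.Ioo 0 1 := by
    ext u
    simp only [Set.mem_inter_iff, Set.mem_preimage, Set.mem_Iic]
    exact and_congr_left fun hu => hQ u hu t
  rw [hset, ← ofReal_measureReal (μ := m) (s := Set.Iic t)]
  set p := m.real (Set.Iic t)
  have hp0 : 0 ≤ p := measureReal_nonneg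
  have hp1 : p ≤ 1 := measureReal_le_one
  refine le_antisymm ?_ ?_
  · have hsub : Set.Iic p ∩ Set.Ioo 0 1 ⊆ Set.Ioc 0 p := fun u hu => ⟨hu.2.1, hu.1⟩
    simpa using measure_mono (μ := volume) hsub
  · have hsub : Set.Ioo 0 p ⊆ Set.Iic p ∩ Set.Ioo 0 1 := fun u hu =>
      ⟨hu.2.le, hu.1, hu.2.trans_le hp1⟩
    simpa using measure_mono (μ := volume) hsub

/-- The Wasserstein-1 distance is at most the `L¹` distance of the distribution functions. -/
theorem W₁_le_lintegral_abs_cdf_sub (μ ν : P₁) :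
    W₁ μ ν ≤ ∫⁻ t, ENNReal.ofReal |μ.meas.real (Set.Iic t) - ν.meas.real (Set.Iic t)| := by
  obtain ⟨Q, hQ⟩ := exists_quantile μ.meas
  obtain ⟨R, hR⟩ := exists_quantile ν.meas
  obtain ⟨hQm, hQμ⟩ := map_quantile hQ
  obtain ⟨hRm, hRν⟩ := map_quantile hR
  set I : Measure ℝ := volume.restrict (Set.Ioo 0 1)
  have hQR : AEMeasurable (fun u => (Q u, R u)) I := hQm.prodMk hRm
  have hmem : I.map (fun u => (Q u, R u)) ∈ couplings μ ν := by
    constructor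
    · rw [AEMeasurable.map_map_of_aemeasurable measurable_fst.aemeasurable hQR]
      exact hQμ
    · rw [AEMeasurable.map_map_of_aemeasurable measurable_snd.aemeasurable hQR]
      exact hRν
  refine (iInf₂_le _ hmem).trans ?_
  rw [lintegral_map' (by fun_prop) hQR]
  set F : ℝ → ℝ := fun t => μ.meas.real (Set.Iic t)
  set G : ℝ → ℝ := fun t => ν.meas.real (Set.Iic t)
  have hFm : Measurable F := Monotone.measurable fun a b h =>
    measureReal_mono (Set.Iic_subset_Iic.2 h)
  have hGm : Measurable G := Monotone.measurable fun a b h =>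
    measureReal_mono (Set.Iic_subset_Iic.2 h)
  -- The region between the graphs of `F` and `G`, with points `(u, t)`. Its section at level `u`
  -- contains an interval of length `|Q u - R u|`; its section at `t` lies in one of length `|F t -
  -- G t|`. Tonelli compares the two.
  set E : Set (ℝ × ℝ) := {p | p.1 ≤ F p.2 ∧ G p.2 < p.1} ∪ {p | p.1 ≤ G p.2 ∧ F p.2 < p.1}
  have hE : MeasurableSet E := by
    have h1 : Measurable fun p : ℝ × ℝ => F p.2 := hFm.comp measurable_snd
    have h2 : Measurable fun p : ℝ × ℝ => G p.2 := hGm.comp measurable_snd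
    exact ((measurableSet_le measurable_fst h1).inter (measurableSet_lt h2 measurable_fst)).union
      ((measurableSet_le measurable_fst h2).inter (measurableSet_lt h1 measurable_fst))
  calc ∫⁻ u, ENNReal.ofReal |Q u - R u| ∂I
      ≤ ∫⁻ u, volume (Prod.mk u ⁻¹' E) ∂I := by
        refine setLIntegral_mono' measurableSet_Ioo fun u hu => ?_
        have hsub : Set.Ico (min (Q u) (R u)) (max (Q u) (R u)) ⊆ Prod.mk u ⁻¹' E := by
          rintro t ⟨h1, h2⟩
          rcases le_total (Q u) (R u) with h | h
          · rw [min_eq_left h] at h1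
            rw [max_eq_right h] at h2
            exact Or.inl ⟨(hQ u hu t).1 h1, not_le.1 fun h' => h2.not_ge ((hR u hu t).2 h')⟩
          · rw [min_eq_right h] at h1
            rw [max_eq_left h] at h2
            exact Or.inr ⟨(hR u hu t).1 h1, not_le.1 fun h' => h2.not_ge ((hQ u hu t).2 h')⟩
        refine le_trans (le_of_eq ?_) (measure_mono hsub)
        rw [Real.volume_Ico, max_sub_min_eq_abs']
    _ = ∫⁻ t, I ((fun u => (u, t)) ⁻¹' E) := by
        rw [← Measure.prod_apply hE, Measure.prod_apply_symm hE]
    _ ≤ ∫⁻ t, ENNReal.ofReal |F t - G t| := by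
        refine lintegral_mono fun t => ?_
        have hsub : (fun u => (u, t)) ⁻¹' E ⊆ Set.Ioc (min (F t) (G t)) (max (F t) (G t)) := by
          rintro u (⟨h1, h2⟩ | ⟨h1, h2⟩)
          · exact ⟨min_lt_of_right_lt h2, le_max_of_le_left h1⟩
          · exact ⟨min_lt_of_left_lt h2, le_max_of_le_right h1⟩
        calc I ((fun u => (u, t)) ⁻¹' E) ≤ volume ((fun u => (u, t)) ⁻¹' E) :=
              Measure.restrict_apply_le _ _
          _ ≤ _ := measure_mono hsub
          _ = _ := by rw [Real.volume_Ioc, max_sub_min_eq_abs']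

/-! ### Analytic properties of integrated survival functions -/

/-- The barycenter of `μ`. -/
noncomputable def mean (μ : P₁) : ℝ := ∫ x, x ∂μ.meas

theorem mean_sub (μ : P₁) (s : ℝ) : μ.mean - s = μ.intDist s + μ.intSurv s :=
  (μ.intDist_add_intSurv s).symm

theorem intSurv_nonneg (μ : P₁) (s : ℝ) : 0 ≤ μ.intSurv s :=
  integral_nonneg fun _ => le_max_right _ _

theorem intDist_nonpos (μ : P₁) (s : ℝ) : μ.intDist s ≤ 0 :=
  integral_nonpos fun _ => min_le_right _ _

theorem antitone_intSurv (μ : P₁) : Antitone μ.intSurv := fun s t h =>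
  integral_mono (μ.integrable_max t) (μ.integrable_max s) fun x =>
    max_le_max (by linarith) le_rfl

theorem antitone_intDist (μ : P₁) : Antitone μ.intDist := fun s t h =>
  integral_mono (μ.integrable_min t) (μ.integrable_min s) fun x =>
    min_le_min (by linarith) le_rfl

theorem monotone_intSurv_add (μ : P₁) : Monotone fun s => μ.intSurv s + s := fun s t h => by
  have := μ.antitone_intDist h
  simp only
  linarith [μ.mean_sub s, μ.mean_sub t]

theorem continuous_intSurv (μ : P₁) : Continuous μ.intSurv := by
  have : LipschitzWith 1 μ.intSurv := by
    refine LipschitzWith.of_le_add fun s t => ?_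
    rw [Real.dist_eq]
    rcases le_total s t with h | h
    · have := μ.monotone_intSurv_add h
      simp only at this
      linarith [neg_abs_le (s - t)]
    · linarith [μ.antitone_intSurv h, abs_nonneg (s - t)]
  exact this.continuous

theorem convexOn_intSurv (μ : P₁) : ConvexOn ℝ Set.univ μ.intSurv := by
  refine ⟨convex_univ, fun s _ t _ a b ha hb hab => ?_⟩
  simp only [smul_eq_mul, intSurv]
  rw [← integral_const_mul, ← integral_const_mul,
    ← integral_add ((μ.integrable_max s).const_mul a) ((μ.integrable_max t).const_mul b)]
  refine integral_mono (μ.integrable_max _)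
    (((μ.integrable_max s).const_mul a).add ((μ.integrable_max t).const_mul b)) fun x => ?_
  refine max_le ?_ (by positivity)
  have h1 := mul_le_mul_of_nonneg_left (le_max_left (x - s) 0) ha
  have h2 := mul_le_mul_of_nonneg_left (le_max_left (x - t) 0) hb
  have h3 : x = a * x + b * x := by rw [← add_mul, hab, one_mul]
  linarith

theorem tendsto_intSurv_atTop (μ : P₁) : Tendsto μ.intSurv atTop (𝓝 0) := by
  have : Tendsto μ.intSurv atTop (𝓝 (∫ _, (0 : ℝ) ∂μ.meas)) := by
    refine tendsto_integral_filter_of_dominated_convergence (fun x => max (x - 0) 0)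
      (Eventually.of_forall fun s => (μ.integrable_max s).aestronglyMeasurable) ?_
      (μ.integrable_max 0) (ae_of_all _ fun x => ?_)
    · filter_upwards [eventually_ge_atTop 0] with s hs
      refine ae_of_all _ fun x => ?_
      rw [Real.norm_eq_abs, abs_of_nonneg (le_max_right _ _)]
      exact max_le_max (by linarith) le_rfl
    · refine tendsto_const_nhds.congr' ?_
      filter_upwards [eventually_ge_atTop x] with s hs
      rw [max_eq_right (by linarith)]
  simpa using this

theorem tendsto_intDist_atBot (μ : P₁) : Tendsto μ.intDist atBot (𝓝 0) := by
  have : Tendsto μ.intDist atBot (𝓝 (∫ _, (0 : ℝ) ∂μ.meas)) := by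
    refine tendsto_integral_filter_of_dominated_convergence (fun x => |min (x - 0) 0|)
      (Eventually.of_forall fun s => (μ.integrable_min s).aestronglyMeasurable) ?_
      (μ.integrable_min 0).abs (ae_of_all _ fun x => ?_)
    · filter_upwards [eventually_le_atBot 0] with s hs
      refine ae_of_all _ fun x => ?_
      rw [Real.norm_eq_abs, abs_of_nonpos (min_le_right _ _), abs_of_nonpos (min_le_right _ _)]
      exact neg_le_neg (min_le_min (by linarith) le_rfl)
    · refine tendsto_const_nhds.congr' ?_
      filter_upwards [eventually_le_atBot x] with s hs
      rw [min_eq_right (by linarith)]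
  simpa using this

theorem mean_le_intSurv_add (μ : P₁) (s : ℝ) : μ.mean ≤ μ.intSurv s + s := by
  linarith [μ.mean_sub s, μ.intDist_nonpos s]

theorem tendsto_intSurv_add_atBot (μ : P₁) :
    Tendsto (fun s => μ.intSurv s + s) atBot (𝓝 μ.mean) := by
  have := (tendsto_const_nhds (x := μ.mean)).sub μ.tendsto_intDist_atBot
  rw [sub_zero] at this
  refine this.congr fun s => ?_
  linarith [μ.mean_sub s]

theorem integrableOn_intSurv (μ : P₁) (s : ℝ) :
    IntegrableOn (fun u => μ.meas.real (Set.Ioi u)) (Set.Ioi s) ∧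
      μ.intSurv s = ∫ u in Set.Ioi s, μ.meas.real (Set.Ioi u) := by
  have hl := lintegral_ofReal_max_sub μ.meas s
  have hfin : ∫⁻ u in Set.Ioi s, μ.meas (Set.Ioi u) ≠ ∞ := by
    rw [← hl]; exact (μ.integrable_max s).lintegral_lt_top.ne
  have hm : Measurable fun u => μ.meas (Set.Ioi u) :=
    Antitone.measurable fun a b h => measure_mono (Set.Ioi_subset_Ioi h)
  refine ⟨integrable_toReal_of_lintegral_ne_top hm.aemeasurable hfin, ?_⟩
  rw [intSurv, integral_eq_lintegral_of_nonneg_ae (f := fun x => max (x - s) 0) (ae_of_all _ fun _ => le_max_right _ _)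
    (μ.integrable_max s).aestronglyMeasurable, hl]
  exact (integral_toReal hm.aemeasurable (ae_of_all _ fun _ => measure_lt_top _ _)).symm

theorem integrableOn_intDist (μ : P₁) (s : ℝ) :
    IntegrableOn (fun u => μ.meas.real (Set.Iic u)) (Set.Iio s) ∧
      -μ.intDist s = ∫ u in Set.Iio s, μ.meas.real (Set.Iic u) := by
  have hl := lintegral_ofReal_neg_min_sub μ.meas s
  have hfin : ∫⁻ u in Set.Iio s, μ.meas (Set.Iic u) ≠ ∞ := by
    rw [← hl]; exact (μ.integrable_min s).neg.lintegral_lt_top.ne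
  have hm : Measurable fun u => μ.meas (Set.Iic u) :=
    Monotone.measurable fun a b h => measure_mono (Set.Iic_subset_Iic.2 h)
  refine ⟨integrable_toReal_of_lintegral_ne_top hm.aemeasurable hfin, ?_⟩
  rw [intDist, ← integral_neg, integral_eq_lintegral_of_nonneg_ae (f := fun x => -min (x - s) 0)
    (ae_of_all _ fun _ => neg_nonneg.2 (min_le_right _ _))
    (μ.integrable_min s).neg.aestronglyMeasurable, hl]
  exact (integral_toReal hm.aemeasurable (ae_of_all _ fun _ => measure_lt_top _ _)).symm

/-- With `sub_le_mul_surv`, this encloses the difference quotients of `intSurv` between survival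
probabilities, by comparing integrands pointwise. -/
theorem sub_mul_surv_le (μ : P₁) {t s : ℝ} (h : t ≤ s) :
    (s - t) * μ.meas.real (Set.Ioi s) ≤ μ.intSurv t - μ.intSurv s := by
  have hind : (s - t) * μ.meas.real (Set.Ioi s)
      = ∫ x, (Set.Ioi s).indicator (fun _ => s - t) x ∂μ.meas := by
    rw [integral_indicator_const _ measurableSet_Ioi, smul_eq_mul, mul_comm]
  rw [hind, intSurv, intSurv, ← integral_sub (μ.integrable_max t) (μ.integrable_max s)]
  refine integral_mono ((integrable_const _).indicator measurableSet_Ioi)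
    ((μ.integrable_max t).sub (μ.integrable_max s)) fun x => ?_
  by_cases hx : s < x
  · simp only [Set.indicator_of_mem (Set.mem_Ioi.2 hx)]
    rw [max_eq_left (by linarith), max_eq_left (by linarith)]
    linarith
  · simp only [Set.indicator_of_notMem (mt Set.mem_Ioi.1 hx)]
    exact sub_nonneg.2 (max_le_max (by linarith) le_rfl)

theorem sub_le_mul_surv (μ : P₁) {t s : ℝ} (h : t ≤ s) :
    μ.intSurv t - μ.intSurv s ≤ (s - t) * μ.meas.real (Set.Ioi t) := by
  have hind : (s - t) * μ.meas.real (Set.Ioi t)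
      = ∫ x, (Set.Ioi t).indicator (fun _ => s - t) x ∂μ.meas := by
    rw [integral_indicator_const _ measurableSet_Ioi, smul_eq_mul, mul_comm]
  rw [hind, intSurv, intSurv, ← integral_sub (μ.integrable_max t) (μ.integrable_max s)]
  refine integral_mono ((μ.integrable_max t).sub (μ.integrable_max s))
    ((integrable_const _).indicator measurableSet_Ioi) fun x => ?_
  by_cases hx : t < x
  · simp only [Set.indicator_of_mem (Set.mem_Ioi.2 hx)]
    rw [max_eq_left (by linarith : 0 ≤ x - t)]
    linarith [le_max_left (x - s) 0]
  · simp only [Set.indicator_of_notMem (mt Set.mem_Ioi.1 hx)]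
    rw [max_eq_right (by linarith), max_eq_right (by linarith)]
    simp

/-! ### From pointwise convergence to Wasserstein convergence -/

/-- Pointwise convergence of integrated survival functions implies convergence of the survival
functions at the continuity points of the limit. -/
theorem tendsto_surv_of_tendsto_intSurv {u : ℕ → P₁} {μ : P₁}
    (h : ∀ s, Tendsto (fun n => (u n).intSurv s) atTop (𝓝 (μ.intSurv s))) {s : ℝ}
    (hs : ContinuousAt (fun t => μ.meas.real (Set.Ioi t)) s) :
    Tendsto (fun n => (u n).meas.real (Set.Ioi s)) atTop (𝓝 (μ.meas.real (Set.Ioi s))) := by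
  have hlim : ∀ t r, Tendsto (fun n => (u n).intSurv t - (u n).intSurv r) atTop
      (𝓝 (μ.intSurv t - μ.intSurv r)) := fun t r => (h t).sub (h r)
  refine tendsto_order.2 ⟨fun a ha => ?_, fun a ha => ?_⟩
  -- Continuity at `s` allows a fixed `t` to the right whose survival probability still exceeds `a`;
  -- the difference quotient on `[s, t]` then passes to the limit in `n`.
  · have hev : ∀ᶠ t in 𝓝[>] s, a < μ.meas.real (Set.Ioi t) :=
      (hs.eventually_const_lt ha).filter_mono nhdsWithin_le_nhds
    obtain ⟨t, hta, hst⟩ := (hev.and self_mem_nhdsWithin).exists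
    have hst : 0 < t - s := sub_pos.2 hst
    have hlt : (t - s) * a < μ.intSurv s - μ.intSurv t :=
      (mul_lt_mul_of_pos_left hta hst).trans_le (μ.sub_mul_surv_le (by linarith))
    filter_upwards [(hlim s t).eventually_const_lt hlt] with n hn
    exact lt_of_mul_lt_mul_left (hn.trans_le ((u n).sub_le_mul_surv (by linarith))) hst.le
  · have hev : ∀ᶠ t in 𝓝[<] s, μ.meas.real (Set.Ioi t) < a :=
      (hs.eventually_lt_const ha).filter_mono nhdsWithin_le_nhds
    obtain ⟨t, hta, hst⟩ := (hev.and self_mem_nhdsWithin).exists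
    have hst : 0 < s - t := sub_pos.2 hst
    have hlt : μ.intSurv t - μ.intSurv s < (s - t) * a :=
      (μ.sub_le_mul_surv (by linarith)).trans_lt (mul_lt_mul_of_pos_left hta hst)
    filter_upwards [(hlim t s).eventually_lt_const hlt] with n hn
    exact lt_of_mul_lt_mul_left (((u n).sub_mul_surv_le (by linarith)).trans_lt hn) hst.le

theorem tendstoW₁_of_tendsto_intSurv {u : ℕ → P₁} {μ : P₁}
    (h : ∀ s, Tendsto (fun n => (u n).intSurv s) atTop (𝓝 (μ.intSurv s)))
    (hmean : Tendsto (fun n => (u n).mean) atTop (𝓝 μ.mean)) : TendstoW₁ u μ := by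
  have hcdf : ∀ (ν : P₁) t, ν.meas.real (Set.Iic t) = 1 - ν.meas.real (Set.Ioi t) := by
    intro ν t
    rw [← Set.compl_Ioi, probReal_compl_eq_one_sub measurableSet_Ioi]
  have hae : ∀ᵐ s : ℝ, Tendsto (fun n => (u n).meas.real (Set.Ioi s)) atTop
      (𝓝 (μ.meas.real (Set.Ioi s))) := by
    have hanti : Antitone fun t => μ.meas.real (Set.Ioi t) := fun a b hab =>
      measureReal_mono (Set.Ioi_subset_Ioi hab)
    filter_upwards [hanti.countable_not_continuousAt.ae_notMem volume] with s hs
    exact tendsto_surv_of_tendsto_intSurv h (by simpa using hs)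
  have hR : Tendsto (fun n => ∫ t in Set.Ioi 0,
      |(u n).meas.real (Set.Ioi t) - μ.meas.real (Set.Ioi t)|) atTop (𝓝 0) := by
    refine tendsto_integral_abs_sub_of_tendsto_integral (fun n => ((u n).integrableOn_intSurv 0).1)
      (μ.integrableOn_intSurv 0).1 (fun _ _ => measureReal_nonneg) (fun _ => measureReal_nonneg)
      (ae_restrict_of_ae hae) ?_
    simp only [← (integrableOn_intSurv _ 0).2]
    exact h 0
  have hL : Tendsto (fun n => ∫ t in Set.Iio 0,
      |(u n).meas.real (Set.Iic t) - μ.meas.real (Set.Iic t)|) atTop (𝓝 0) := by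
    refine tendsto_integral_abs_sub_of_tendsto_integral (fun n => ((u n).integrableOn_intDist 0).1)
      (μ.integrableOn_intDist 0).1 (fun _ _ => measureReal_nonneg) (fun _ => measureReal_nonneg)
      (ae_restrict_of_ae ?_) ?_
    · filter_upwards [hae] with t ht
      simp only [hcdf]
      exact tendsto_const_nhds.sub ht
    · simp only [← (integrableOn_intDist _ 0).2]
      -- Convergence of the means enters here: it gives Scheffé's lemma the convergence of the
      -- left-tail integrals.
      have hd : ∀ ν : P₁, -ν.intDist 0 = ν.intSurv 0 - ν.mean := fun ν => by
        linarith [ν.mean_sub 0]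
      simp only [hd]
      exact (h 0).sub hmean
  have hW : ∀ n, W₁ (u n) μ ≤ ENNReal.ofReal (∫ t in Set.Iio 0,
      |(u n).meas.real (Set.Iic t) - μ.meas.real (Set.Iic t)|) + ENNReal.ofReal
      (∫ t in Set.Ioi 0, |(u n).meas.real (Set.Ioi t) - μ.meas.real (Set.Ioi t)|) := by
    intro n
    rw [ofReal_integral_eq_lintegral_ofReal
        (by exact (((u n).integrableOn_intDist 0).1.sub (μ.integrableOn_intDist 0).1).abs)
        (ae_of_all _ fun _ => abs_nonneg _),
      ofReal_integral_eq_lintegral_ofReal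
        (by exact (((u n).integrableOn_intSurv 0).1.sub (μ.integrableOn_intSurv 0).1).abs)
        (ae_of_all _ fun _ => abs_nonneg _)]
    refine (W₁_le_lintegral_abs_cdf_sub (u n) μ).trans (le_of_eq ?_)
    -- Split at `0`: distribution functions are integrable only on the left, survival functions only
    -- on the right, and their differences agree in absolute value.
    rw [← lintegral_add_compl _ (measurableSet_Iio (a := (0 : ℝ))), Set.compl_Iio,
      setLIntegral_congr (Ioi_ae_eq_Ici (μ := volume) (a := (0 : ℝ))).symm]
    congr 1
    refine lintegral_congr fun t => ?_
    rw [hcdf, hcdf, abs_sub_comm, sub_sub_sub_cancel_left]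
  have hsum := (ENNReal.tendsto_ofReal hL).add (ENNReal.tendsto_ofReal hR)
  simp only [ENNReal.ofReal_zero, add_zero] at hsum
  exact tendsto_of_tendsto_of_tendsto_of_le_of_le tendsto_const_nhds hsum
    (fun _ => zero_le) hW

end P₁

/-! ### Which functions are integrated survival functions -/

/-- Fundamental theorem of calculus on `(a, ∞)` for a nonnegative right derivative. -/
theorem integral_Ioi_of_hasDerivWithinAt_Ioi_of_nonneg {g g' : ℝ → ℝ} {l : ℝ} (hg : Continuous g)
    (hd : ∀ x, HasDerivWithinAt g (g' x) (Set.Ioi x) x) (h0 : ∀ x, 0 ≤ g' x)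
    (hint : ∀ a b, IntervalIntegrable g' volume a b) (hl : Tendsto g atTop (𝓝 l)) (a : ℝ) :
    IntegrableOn g' (Set.Ioi a) ∧ ∫ x in Set.Ioi a, g' x = l - g a := by
  have hFTC : ∀ b, ∫ x in a..b, g' x = g b - g a := fun b =>
    intervalIntegral.integral_eq_sub_of_hasDeriv_right hg.continuousOn (fun x _ => hd x) (hint a b)
  have hlim : Tendsto (fun b => g b - g a) atTop (𝓝 (l - g a)) := hl.sub tendsto_const_nhds
  have hi : IntegrableOn g' (Set.Ioi a) := by
    refine integrableOn_Ioi_of_intervalIntegral_norm_tendsto (l - g a) a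
      (fun b => (hint a b).1) tendsto_id ?_
    simp only [Real.norm_of_nonneg (h0 _), hFTC]
    exact hlim
  refine ⟨hi, tendsto_nhds_unique (intervalIntegral_tendsto_integral_Ioi a hi tendsto_id) ?_⟩
  simpa only [id, hFTC] using hlim

/-- A nonnegative right derivative of a function with a limit at `-∞` is integrable
on `(-∞, a]`. -/
theorem integrableOn_Iic_of_hasDerivWithinAt_Ioi_of_nonneg {g g' : ℝ → ℝ} {l : ℝ}
    (hg : Continuous g) (hd : ∀ x, HasDerivWithinAt g (g' x) (Set.Ioi x) x) (h0 : ∀ x, 0 ≤ g' x)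
    (hint : ∀ a b, IntervalIntegrable g' volume a b) (hl : Tendsto g atBot (𝓝 l)) (a : ℝ) :
    IntegrableOn g' (Set.Iic a) := by
  refine integrableOn_Iic_of_intervalIntegral_norm_tendsto (g a - l) a
    (fun b => (hint b a).1) tendsto_id ?_
  have hFTC : ∀ b, ∫ x in b..a, g' x = g a - g b := fun b =>
    intervalIntegral.integral_eq_sub_of_hasDeriv_right hg.continuousOn (fun x _ => hd x) (hint b a)
  simp only [Real.norm_of_nonneg (h0 _), hFTC]
  exact tendsto_const_nhds.sub hl

namespace P₁

/-- Characterization of integrated survival functions. -/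
theorem exists_intSurv_eq {f : ℝ → ℝ} (hconv : ConvexOn ℝ Set.univ f) (hanti : Antitone f)
    (hmono : Monotone fun s => f s + s) (htop : Tendsto f atTop (𝓝 0)) {c : ℝ}
    (hc : ∀ s, c ≤ f s + s) : ∃ μ : P₁, ∀ s, μ.intSurv s = f s := by
  have hcont : Continuous f := continuousOn_univ.1 (hconv.continuousOn isOpen_univ)
  obtain ⟨m, hbot⟩ : ∃ m, Tendsto (fun s => f s + s) atBot (𝓝 m) :=
    ⟨_, tendsto_atBot_ciInf hmono ⟨c, by rintro _ ⟨s, rfl⟩; exact hc s⟩⟩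
  set r : ℝ → ℝ := fun x => derivWithin f (Set.Ioi x) x
  have hint : ∀ x : ℝ, x ∈ interior (Set.univ : Set ℝ) := fun x => by simp
  have hd : ∀ x, HasDerivWithinAt f (r x) (Set.Ioi x) x := fun x =>
    hconv.hasDerivWithinAt_rightDeriv_of_mem_interior (hint x)
  have hrmono : Monotone r := fun x y h => hconv.monotoneOn_rightDeriv (hint x) (hint y) h
  -- By convexity the right derivative lies between the backward and forward unit increments of `f`.
  -- This yields `-1 ≤ r ≤ 0` and the limits of `r` at both ends.
  have hru : ∀ x, r x ≤ f (x + 1) - f x := fun x => by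
    have := hconv.rightDeriv_le_slope_of_mem_interior (hint x) (Set.mem_univ (x + 1)) (by linarith)
    simpa [slope_def_field] using this
  have hrl : ∀ x, f x - f (x - 1) ≤ r x := fun x => by
    have := (hconv.slope_le_leftDeriv_of_mem_interior (Set.mem_univ (x - 1)) (hint x)
      (by linarith)).trans (hconv.leftDeriv_le_rightDeriv_of_mem_interior (hint x))
    simpa [slope_def_field] using this
  have hr0 : ∀ x, r x ≤ 0 := fun x => (hru x).trans (sub_nonpos.2 (hanti (by linarith)))
  have hr1 : ∀ x, -1 ≤ r x := fun x => by
    have : f (x - 1) + (x - 1) ≤ f x + x := hmono (by linarith)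
    linarith [hrl x]
  have hGmono : Monotone fun x => 1 + r x := fun x y h => by
    have := hrmono h
    simp only
    linarith
  have hG0 : Tendsto (fun x => 1 + r x) atBot (𝓝 0) := by
    have h1 : Tendsto (fun x => (f (x + 1) + (x + 1)) - (f x + x)) atBot (𝓝 0) := by
      have := (hbot.comp (tendsto_atBot_add_const_right atBot (1 : ℝ) tendsto_id)).sub hbot
      rw [sub_self] at this
      exact this
    refine tendsto_of_tendsto_of_tendsto_of_le_of_le tendsto_const_nhds h1 (fun x => ?_) fun x => ?_
    · have := hr1 x
      simp only
      linarith
    · have := hru x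
      simp only
      linarith
  have hG1 : Tendsto (fun x => 1 + r x) atTop (𝓝 1) := by
    have h1 : Tendsto (fun x => 1 + (f x - f (x - 1))) atTop (𝓝 1) := by
      have := (htop.sub (htop.comp (tendsto_atTop_add_const_right atTop (-1 : ℝ)
        tendsto_id))).const_add 1
      rw [sub_self, add_zero] at this
      exact this
    refine tendsto_of_tendsto_of_tendsto_of_le_of_le h1 tendsto_const_nhds (fun x => ?_) fun x => ?_
    · have := hrl x
      simp only
      linarith
    · have := hr0 x
      simp only
      linarith
  -- `1 + r` is the candidate distribution function; its right-continuous version differs from it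
  -- only at countably many points.
  set F := hGmono.stieltjesFunction
  have hFl : ∀ x, 1 + r x ≤ F x := fun x => hGmono.le_rightLim le_rfl
  have hFu : ∀ x, F x ≤ 1 + r (x + 1) := fun x => hGmono.rightLim_le (by linarith)
  have hF0 : Tendsto F atBot (𝓝 0) :=
    tendsto_of_tendsto_of_tendsto_of_le_of_le hG0
      (hG0.comp (tendsto_atBot_add_const_right atBot (1 : ℝ) tendsto_id)) hFl hFu
  have hF1 : Tendsto F atTop (𝓝 1) :=
    tendsto_of_tendsto_of_tendsto_of_le_of_le hG1
      (hG1.comp (tendsto_atTop_add_const_right atTop (1 : ℝ) tendsto_id)) hFl hFu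
  have hFae : ∀ᵐ x, F x = 1 + r x := by
    filter_upwards [hGmono.countable_not_continuousAt.ae_notMem volume] with x hx
    have hx : ContinuousAt (fun x => 1 + r x) x := by simpa using hx
    exact hx.continuousWithinAt.rightLim_eq
  have hprob : IsProbabilityMeasure F.measure := F.isProbabilityMeasure hF0 hF1
  have hpos : ∀ s, ∫⁻ x, ENNReal.ofReal (max (x - s) 0) ∂F.measure = ENNReal.ofReal (f s) := by
    intro s
    obtain ⟨hi, he⟩ := integral_Ioi_of_hasDerivWithinAt_Ioi_of_nonneg (g := fun x => -f x)
      (g' := fun x => -r x) hcont.neg (fun x => (hd x).neg) (fun x => neg_nonneg.2 (hr0 x))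
      (fun a b => hrmono.intervalIntegrable.neg) htop.neg s
    rw [lintegral_ofReal_max_sub]
    simp only [F.measure_Ioi hF1]
    have : ∫⁻ u in Set.Ioi s, ENNReal.ofReal (1 - F u)
        = ∫⁻ u in Set.Ioi s, ENNReal.ofReal (-r u) := by
      refine lintegral_congr_ae (ae_restrict_of_ae ?_)
      filter_upwards [hFae] with u hu
      rw [hu, sub_add_cancel_left]
    rw [this, ← ofReal_integral_eq_lintegral_ofReal hi (ae_of_all _ fun x => neg_nonneg.2 (hr0 x)),
      he]
    congr 1
    ring
  -- The left tail is the integral of the derivative of `f x + x`, finite because this function has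
  -- a limit at `-∞`; that is the role of the lower bound `c`.
  have hneg : ∫⁻ x, ENNReal.ofReal (-min (x - 0) 0) ∂F.measure ≠ ∞ := by
    have hi := integrableOn_Iic_of_hasDerivWithinAt_Ioi_of_nonneg (g := fun x => f x + x)
      (g' := fun x => r x + 1) (hcont.add continuous_id)
      (fun x => (hd x).add (hasDerivWithinAt_id x _)) (fun x => by linarith [hr1 x])
      (fun a b => hrmono.intervalIntegrable.add intervalIntegrable_const) hbot 0
    rw [lintegral_ofReal_neg_min_sub]
    simp only [F.measure_Iic hF0]
    have : ∫⁻ u in Set.Iio 0, ENNReal.ofReal (F u - 0)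
        = ∫⁻ u in Set.Iio 0, ENNReal.ofReal (r u + 1) := by
      refine lintegral_congr_ae (ae_restrict_of_ae ?_)
      filter_upwards [hFae] with u hu
      rw [hu, sub_zero, add_comm]
    rw [this]
    exact (hi.mono_set Set.Iio_subset_Iic_self).lintegral_lt_top.ne
  have hmax : Integrable (fun x : ℝ => max (x - 0) 0) F.measure :=
    (lintegral_ofReal_ne_top_iff_integrable (f := fun x : ℝ => max (x - 0) 0) (by fun_prop)
      (ae_of_all _ fun _ => le_max_right _ _)).1 (by rw [hpos]; exact ENNReal.ofReal_ne_top)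
  have hmin : Integrable (fun x : ℝ => -min (x - 0) 0) F.measure :=
    (lintegral_ofReal_ne_top_iff_integrable (by fun_prop)
      (ae_of_all _ fun _ => neg_nonneg.2 (min_le_right _ _))).1 hneg
  have hid : Integrable (fun x : ℝ => x) F.measure := by
    refine (hmax.sub hmin).congr (ae_of_all _ fun x => ?_)
    have := min_add_max (x - 0) 0
    simp only [Pi.sub_apply]
    linarith
  refine ⟨⟨F.measure, hprob, hid⟩, fun s => ?_⟩
  have hf0 : 0 ≤ f s := hanti.le_of_tendsto htop s
  change ∫ x, max (x - s) 0 ∂F.measure = f s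
  rw [integral_eq_lintegral_of_nonneg_ae (f := fun x => max (x - s) 0)
    (ae_of_all _ fun _ => le_max_right _ _) (by fun_prop), hpos, ENNReal.toReal_ofReal hf0]

end P₁

/-! ### Monotone sequences in directed sets and order duality -/

theorem DirectedOn.exists_seq {α : Type*} {r : α → α → Prop} {M C : Set α} (hM : DirectedOn r M)
    (hne : M.Nonempty) (hCM : C ⊆ M) (hC : C.Countable) :
    ∃ u : ℕ → α, (∀ n, u n ∈ M) ∧ (∀ n, r (u n) (u (n + 1))) ∧ ∀ c ∈ C, ∃ n, r c (u n) := by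
  obtain ⟨x, hx⟩ := hne
  obtain ⟨c, hc⟩ := (hC.insert x).exists_eq_range (Set.insert_nonempty x C)
  have hcM : ∀ n, c n ∈ M := fun n =>
    Set.insert_subset hx hCM (hc ▸ Set.mem_range_self n)
  choose d hdM hd1 hd2 using fun (a b : M) => hM a a.2 b b.2
  -- Each term bounds both its predecessor and the next element of the enumeration.
  let u : ℕ → M := fun n => Nat.rec ⟨x, hx⟩ (fun k a => ⟨d a ⟨c k, hcM k⟩, hdM _ _⟩) n
  refine ⟨fun n => (u n).1, fun n => (u n).2, fun n => ?_, fun a ha => ?_⟩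
  · exact hd1 (u n) ⟨c n, hcM n⟩
  obtain ⟨k, rfl⟩ : a ∈ Set.range c := hc ▸ Set.mem_insert_of_mem x ha
  exact ⟨k + 1, hd2 (u k) ⟨c k, hcM k⟩⟩

theorem isLUB_iff_isGLB_image {L L' : Type*} [PartialOrder L] [PartialOrder L'] (e : L ≃ L')
    (he : ∀ a b, a ≤ b ↔ e b ≤ e a) {M : Set L} {x : L} : IsLUB M x ↔ IsGLB (e '' M) (e x) := by
  simp only [IsLUB, IsGLB, IsLeast, IsGreatest, mem_upperBounds, mem_lowerBounds,
    Set.forall_mem_image, he]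
  exact and_congr_right fun _ => e.forall_congr fun _ => Iff.rfl

theorem isGLB_iff_isLUB_image {L L' : Type*} [PartialOrder L] [PartialOrder L'] (e : L ≃ L')
    (he : ∀ a b, a ≤ b ↔ e b ≤ e a) {M : Set L} {x : L} : IsGLB M x ↔ IsLUB (e '' M) (e x) := by
  simp only [IsLUB, IsGLB, IsLeast, IsGreatest, mem_upperBounds, mem_lowerBounds,
    Set.forall_mem_image, he]
  exact and_congr_right fun _ => e.forall_congr fun _ => Iff.rfl

theorem IsDedekindSuperComplete.of_antitone_equiv {L L' : Type*} [PartialOrder L] [PartialOrder L'] (e : L ≃ L')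
    (he : ∀ a b, a ≤ b ↔ e b ≤ e a)
    (h : IsDedekindSuperComplete L') :
    IsDedekindSuperComplete L where
  isLattice A hA hne := by
    obtain ⟨⟨x, hx⟩, y, hy⟩ := h.isLattice (e '' A) (hA.image e) (hne.image e)
    refine ⟨⟨e.symm y, ?_⟩, e.symm x, ?_⟩
    · rw [isLUB_iff_isGLB_image e he, e.apply_symm_apply]; exact hy
    · rw [isGLB_iff_isLUB_image e he, e.apply_symm_apply]; exact hx
  exists_isLUB M hne hb := by
    obtain ⟨b, hb⟩ := hb
    obtain ⟨x, hx, C, hCM, hC, hCx⟩ := h.exists_isGLB (e '' M) (hne.image e)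
      ⟨e b, Set.forall_mem_image.2 fun a ha => (he a b).1 (hb ha)⟩
    refine ⟨e.symm x, ?_, e.symm '' C, ?_, hC.image _, ?_⟩
    · rw [isLUB_iff_isGLB_image e he, e.apply_symm_apply]; exact hx
    · rw [← e.symm_image_image M]; exact Set.image_mono hCM
    · rw [isLUB_iff_isGLB_image e he, e.apply_symm_apply, e.image_symm_image]; exact hCx
  exists_isGLB M hne hb := by
    obtain ⟨b, hb⟩ := hb
    obtain ⟨x, hx, C, hCM, hC, hCx⟩ := h.exists_isLUB (e '' M) (hne.image e)
      ⟨e b, Set.forall_mem_image.2 fun a ha => (he b a).1 (hb ha)⟩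
    refine ⟨e.symm x, ?_, e.symm '' C, ?_, hC.image _, ?_⟩
    · rw [isGLB_iff_isLUB_image e he, e.apply_symm_apply]; exact hx
    · rw [← e.symm_image_image M]; exact Set.image_mono hCM
    · rw [isGLB_iff_isLUB_image e he, e.apply_symm_apply, e.image_symm_image]; exact hCx

/-! ### Dedekind super completeness for `icx` -/

namespace P₁

/-- Every set of measures has a countable subset with the same continuous upper and lower bounds
for its integrated survival functions. -/
theorem exists_countable_subset (M : Set P₁) : ∃ C ⊆ M, C.Countable ∧
    (∀ g : ℝ → ℝ, Continuous g → (∀ μ ∈ C, ∀ s, μ.intSurv s ≤ g s) →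
      ∀ μ ∈ M, ∀ s, μ.intSurv s ≤ g s) ∧
    (∀ g : ℝ → ℝ, Continuous g → (∀ μ ∈ C, ∀ s, g s ≤ μ.intSurv s) →
      ∀ μ ∈ M, ∀ s, g s ≤ μ.intSurv s) := by
  -- Bounds by `g` at rational points are closed conditions in the product topology, so they pass
  -- from a dense countable subset of the image to all of `M`, and by continuity from `ℚ` to `ℝ`.
  let Φ : P₁ → ℚ → ℝ := fun μ q => μ.intSurv q
  obtain ⟨t, htM, htc, hMt⟩ :=
    (TopologicalSpace.IsSeparable.of_separableSpace (Φ '' M)).exists_countable_dense_subset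
  choose k hkM hk using fun p : t => htM p.2
  have := htc.to_subtype
  refine ⟨Set.range k, ?_, Set.countable_range k, fun g hg h μ hμ => ?_, fun g hg h μ hμ => ?_⟩
  · rintro _ ⟨p, rfl⟩; exact hkM p
  · refine isClosed_property Rat.denseRange_cast (isClosed_le μ.continuous_intSurv hg) ?_
    have hcl : IsClosed {φ : ℚ → ℝ | ∀ q : ℚ, φ q ≤ g q} := by
      simp only [Set.ofPred_forall]
      exact isClosed_iInter fun q => isClosed_le (continuous_apply q) continuous_const
    have hsub : t ⊆ {φ : ℚ → ℝ | ∀ q : ℚ, φ q ≤ g q} := fun p hp q => by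
      have := hk ⟨p, hp⟩
      simp only at this
      rw [← this]
      exact h _ ⟨⟨p, hp⟩, rfl⟩ q
    exact closure_minimal hsub hcl (hMt ⟨μ, hμ, rfl⟩)
  · refine isClosed_property Rat.denseRange_cast (isClosed_le hg μ.continuous_intSurv) ?_
    have hcl : IsClosed {φ : ℚ → ℝ | ∀ q : ℚ, g q ≤ φ q} := by
      simp only [Set.ofPred_forall]
      exact isClosed_iInter fun q => isClosed_le continuous_const (continuous_apply q)
    have hsub : t ⊆ {φ : ℚ → ℝ | ∀ q : ℚ, g q ≤ φ q} := fun p hp q => by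
      have := hk ⟨p, hp⟩
      simp only at this
      rw [← this]
      exact h _ ⟨⟨p, hp⟩, rfl⟩ q
    exact closure_minimal hsub hcl (hMt ⟨μ, hμ, rfl⟩)

/-- The pointwise supremum belongs to the characterized class. The majorant `h` need not come from a
measure, so this also serves finite sets, with a sum as majorant. -/
theorem exists_isLUB_of_intSurv_le {M : Set P₁} (hne : M.Nonempty) {h : ℝ → ℝ}
    (hh : Tendsto h atTop (𝓝 0)) (hM : ∀ μ ∈ M, ∀ s, μ.intSurv s ≤ h s) :
    ∃ ρ, @IsLUB P₁ icx.toLE M ρ := by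
  have : Nonempty M := hne.to_subtype
  obtain ⟨μ₀, hμ₀⟩ := hne
  have hb : ∀ s, BddAbove (Set.range fun μ : M => μ.1.intSurv s) := fun s =>
    ⟨h s, by rintro _ ⟨μ, rfl⟩; exact hM μ μ.2 s⟩
  set f : ℝ → ℝ := fun s => ⨆ μ : M, μ.1.intSurv s
  have hle : ∀ μ ∈ M, ∀ s, μ.intSurv s ≤ f s := fun μ hμ s => le_ciSup (hb s) ⟨μ, hμ⟩
  have hconv : ConvexOn ℝ Set.univ f := by
    refine ⟨convex_univ, fun x _ y _ a b ha hb' hab => ciSup_le fun μ => ?_⟩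
    refine (μ.1.convexOn_intSurv.2 (Set.mem_univ x) (Set.mem_univ y) ha hb' hab).trans ?_
    simp only [smul_eq_mul]
    exact add_le_add (mul_le_mul_of_nonneg_left (hle μ μ.2 x) ha)
      (mul_le_mul_of_nonneg_left (hle μ μ.2 y) hb')
  obtain ⟨ρ, hρ⟩ := exists_intSurv_eq hconv
    (fun s t hst => ciSup_le fun μ => (μ.1.antitone_intSurv hst).trans (hle μ μ.2 s))
    (fun s t hst => by
      have : f s ≤ f t + t - s := ciSup_le fun μ => by
        have := μ.1.monotone_intSurv_add hst
        simp only at this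
        linarith [hle μ μ.2 t]
      simp only
      linarith)
    (tendsto_of_tendsto_of_tendsto_of_le_of_le tendsto_const_nhds hh
      (fun s => (μ₀.intSurv_nonneg s).trans (hle μ₀ hμ₀ s)) fun s => ciSup_le fun μ => hM μ μ.2 s)
    (c := μ₀.mean) (fun s => by linarith [μ₀.mean_le_intSurv_add s, hle μ₀ hμ₀ s])
  refine ⟨ρ, fun μ hμ s => ?_, fun ν hν s => ?_⟩
  · rw [hρ]; exact hle μ hμ s
  · rw [hρ]; exact ciSup_le fun μ => hν μ.2 s

/-- The Dirac measure at `c`. -/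
noncomputable def dirac (c : ℝ) : P₁ :=
  ⟨Measure.dirac c, inferInstance, integrable_dirac (by simp)⟩

theorem dirac_intSurv_le {μ : P₁} {c : ℝ} (h : c ≤ μ.mean) (s : ℝ) :
    (dirac c).intSurv s ≤ μ.intSurv s := by
  have : (dirac c).intSurv s = max (c - s) 0 :=
    integral_dirac (fun x : ℝ => max (x - s) 0) c
  rw [this]
  exact max_le (by linarith [μ.mean_le_intSurv_add s]) (μ.intSurv_nonneg s)

theorem exists_isGLB_icx {M : Set P₁} (hne : M.Nonempty) (hb : @BddBelow P₁ icx.toLE M) :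
    ∃ ρ, @IsGLB P₁ icx.toLE M ρ := by
  obtain ⟨μ, hμ⟩ := hne
  obtain ⟨ρ, hρ⟩ := exists_isLUB_of_intSurv_le hb μ.tendsto_intSurv_atTop
    fun ν hν s => hν hμ s
  exact ⟨ρ, (@isLUB_lowerBounds P₁ icx.toPreorder M ρ).1 hρ⟩

theorem isDedekindSuperComplete_icx : @IsDedekindSuperComplete P₁ icx := by
  let := icx
  refine ⟨fun A hA hne => ⟨?_, ?_⟩, fun M hne hb => ?_, fun M hne hb => ?_⟩
  · refine exists_isLUB_of_intSurv_le hne (h := fun s => ∑ μ ∈ hA.toFinset, μ.intSurv s) ?_ ?_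
    · simpa using tendsto_finsetSum hA.toFinset fun μ _ => μ.tendsto_intSurv_atTop
    · intro μ hμ s
      exact Finset.single_le_sum (f := fun μ : P₁ => μ.intSurv s)
        (fun μ _ => μ.intSurv_nonneg s) (hA.mem_toFinset.2 hμ)
  -- By Jensen, the Dirac mass at a lower bound of the means is a lower bound of the set.
  · obtain ⟨c, hc⟩ := (hA.image mean).bddBelow
    exact exists_isGLB_icx hne ⟨dirac c, fun μ hμ => dirac_intSurv_le (hc ⟨μ, hμ, rfl⟩)⟩
  · obtain ⟨b, hb⟩ := hb
    obtain ⟨ρ, hρ⟩ := exists_isLUB_of_intSurv_le hne b.tendsto_intSurv_atTop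
      fun ν hν s => hb hν s
    obtain ⟨C, hCM, hC, hup, -⟩ := exists_countable_subset M
    exact ⟨ρ, hρ, C, hCM, hC, fun μ hμ => hρ.1 (hCM hμ), fun ν hν => hρ.2 fun μ hμ =>
      hup _ ν.continuous_intSurv (fun κ hκ => hν hκ) μ hμ⟩
  · obtain ⟨ρ, hρ⟩ := exists_isGLB_icx hne hb
    obtain ⟨C, hCM, hC, -, hlow⟩ := exists_countable_subset M
    exact ⟨ρ, hρ, C, hCM, hC, fun μ hμ => hρ.1 (hCM hμ), fun ν hν => hρ.2 fun μ hμ =>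
      hlow _ ν.continuous_intSurv (fun κ hκ => hν hκ) μ hμ⟩

/-! ### Limits along directed sets for `icx` -/

theorem mean_le_mean_of_intDist_le {μ ν : P₁} (h : ∀ s, μ.intDist s ≤ ν.intDist s) :
    μ.mean ≤ ν.mean := by
  have hl : Tendsto (fun s => μ.mean - μ.intSurv s) atTop (𝓝 (μ.mean - 0)) :=
    tendsto_const_nhds.sub μ.tendsto_intSurv_atTop
  rw [sub_zero] at hl
  refine le_of_tendsto' hl fun s => ?_
  linarith [μ.mean_sub s, ν.mean_sub s, h s, ν.intSurv_nonneg s]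

/-- The defining inequalities of the class survive pointwise limits; `h` and `c` preserve the
conditions at infinity. This covers decreasing limits too, where a pointwise infimum of an arbitrary
family need not be convex. -/
theorem exists_intSurv_eq_of_tendsto {u : ℕ → P₁} {f h : ℝ → ℝ} {c : ℝ}
    (hu : ∀ s, Tendsto (fun n => (u n).intSurv s) atTop (𝓝 (f s)))
    (hh : Tendsto h atTop (𝓝 0)) (huh : ∀ n s, (u n).intSurv s ≤ h s)
    (hc : ∀ n, c ≤ (u n).mean) : ∃ μ : P₁, ∀ s, μ.intSurv s = f s := by
  refine exists_intSurv_eq ⟨convex_univ, fun x _ y _ a b ha hb hab => ?_⟩ (fun s t hst => ?_)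
    (fun s t hst => ?_) ?_ (c := c) fun s => ?_
  · exact le_of_tendsto_of_tendsto' (hu _) (((hu x).const_smul a).add ((hu y).const_smul b))
      fun n => (u n).convexOn_intSurv.2 (Set.mem_univ x) (Set.mem_univ y) ha hb hab
  · exact le_of_tendsto_of_tendsto' (hu t) (hu s) fun n => (u n).antitone_intSurv hst
  · exact le_of_tendsto_of_tendsto' ((hu s).add_const s) ((hu t).add_const t)
      fun n => (u n).monotone_intSurv_add hst
  · exact tendsto_of_tendsto_of_tendsto_of_le_of_le tendsto_const_nhds hh
      (fun s => ge_of_tendsto' (hu s) fun n => (u n).intSurv_nonneg s)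
      fun s => le_of_tendsto' (hu s) fun n => huh n s
  · exact ge_of_tendsto' ((hu s).add_const s) fun n =>
      (hc n).trans ((u n).mean_le_intSurv_add s)

theorem tendsto_mean_of_tendsto_intSurv {u : ℕ → P₁} {μ ρ : P₁}
    (hu : ∀ s, Tendsto (fun n => (u n).intSurv s) atTop (𝓝 (μ.intSurv s)))
    (hρ : ∀ n s, ρ.intDist s ≤ (u n).intDist s) :
    Tendsto (fun n => (u n).mean) atTop (𝓝 μ.mean) := by
  refine tendsto_order.2 ⟨fun a ha => ?_, fun a ha => ?_⟩
  -- The mean of `u n` is at least `ρ.intDist s + (u n).intSurv s + s`. Fix `s` far to the left,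
  -- where `ρ.intDist s` is negligible, before letting `n` grow.
  · have hlim : Tendsto (fun s => ρ.intDist s + (μ.intSurv s + s)) atBot (𝓝 μ.mean) := by
      simpa using ρ.tendsto_intDist_atBot.add μ.tendsto_intSurv_add_atBot
    obtain ⟨s, hs⟩ := (hlim.eventually_const_lt ha).exists
    have := ((hu s).add_const s).const_add (ρ.intDist s)
    filter_upwards [this.eventually_const_lt hs] with n hn
    linarith [(u n).mean_sub s, hρ n s]
  · obtain ⟨s, hs⟩ := (μ.tendsto_intSurv_add_atBot.eventually_lt_const ha).exists
    filter_upwards [((hu s).add_const s).eventually_lt_const hs] with n hn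
    exact ((u n).mean_le_intSurv_add s).trans_lt hn

theorem exists_seq_tendsto_isLUB_icx {M : Set P₁} (hne : M.Nonempty)
    (hbelow : @BddBelow P₁ icv.toLE M) (habove : @BddAbove P₁ icx.toLE M)
    (hdir : DirectedOn (fun μ ν => icx.le μ ν) M) :
    ∃ (u : ℕ → P₁) (μ : P₁), (∀ n, u n ∈ M) ∧ (∀ n, icx.le (u n) (u (n + 1))) ∧
      @IsLUB P₁ icx.toLE M μ ∧
      (∀ s, Tendsto (fun n => (u n).intSurv s) atTop (𝓝 (μ.intSurv s))) ∧
      Tendsto (fun n => (u n).mean) atTop (𝓝 μ.mean) := by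
  obtain ⟨ρ, hρ⟩ := hbelow
  obtain ⟨σ, hσ⟩ := habove
  obtain ⟨C, hCM, hC, hup, -⟩ := exists_countable_subset M
  obtain ⟨u, huM, hu, hCu⟩ := hdir.exists_seq hne hCM hC
  have hmono : ∀ s, Monotone fun n => (u n).intSurv s := fun s =>
    monotone_nat_of_le_succ fun n => hu n s
  have hlim : ∀ s, Tendsto (fun n => (u n).intSurv s) atTop (𝓝 (⨆ n, (u n).intSurv s)) :=
    fun s => tendsto_atTop_ciSup (hmono s) ⟨σ.intSurv s, by rintro _ ⟨n, rfl⟩; exact hσ (huM n) s⟩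
  obtain ⟨μ, hμ⟩ := exists_intSurv_eq_of_tendsto hlim σ.tendsto_intSurv_atTop
    (fun n s => hσ (huM n) s) (fun n => mean_le_mean_of_intDist_le (hρ (huM n)))
  simp only [← hμ] at hlim
  refine ⟨u, μ, huM, hu, ⟨?_, fun ν hν s => ?_⟩, hlim,
    tendsto_mean_of_tendsto_intSurv hlim fun n => hρ (huM n)⟩
  · refine fun κ hκ => hup _ μ.continuous_intSurv (fun κ hκ s => ?_) κ hκ
    obtain ⟨n, hn⟩ := hCu κ hκ
    exact (hn s).trans ((hmono s).ge_of_tendsto (hlim s) n)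
  · exact le_of_tendsto' (hlim s) fun n => hν (huM n) s

theorem exists_seq_tendsto_isGLB_icx {M : Set P₁} (hne : M.Nonempty)
    (hbelow : @BddBelow P₁ icv.toLE M) (habove : @BddAbove P₁ icx.toLE M)
    (hdir : DirectedOn (fun μ ν => icx.le ν μ) M) :
    ∃ (u : ℕ → P₁) (μ : P₁), (∀ n, u n ∈ M) ∧ (∀ n, icx.le (u (n + 1)) (u n)) ∧
      @IsGLB P₁ icx.toLE M μ ∧
      (∀ s, Tendsto (fun n => (u n).intSurv s) atTop (𝓝 (μ.intSurv s))) ∧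
      Tendsto (fun n => (u n).mean) atTop (𝓝 μ.mean) := by
  obtain ⟨ρ, hρ⟩ := hbelow
  obtain ⟨σ, hσ⟩ := habove
  obtain ⟨C, hCM, hC, -, hlow⟩ := exists_countable_subset M
  obtain ⟨u, huM, hu, hCu⟩ := hdir.exists_seq hne hCM hC
  have hmono : ∀ s, Antitone fun n => (u n).intSurv s := fun s =>
    antitone_nat_of_succ_le fun n => hu n s
  have hlim : ∀ s, Tendsto (fun n => (u n).intSurv s) atTop (𝓝 (⨅ n, (u n).intSurv s)) :=
    fun s => tendsto_atTop_ciInf (hmono s) ⟨0, by rintro _ ⟨n, rfl⟩; exact (u n).intSurv_nonneg s⟩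
  obtain ⟨μ, hμ⟩ := exists_intSurv_eq_of_tendsto hlim σ.tendsto_intSurv_atTop
    (fun n s => hσ (huM n) s) (fun n => mean_le_mean_of_intDist_le (hρ (huM n)))
  simp only [← hμ] at hlim
  refine ⟨u, μ, huM, hu, ⟨?_, fun ν hν s => ?_⟩, hlim,
    tendsto_mean_of_tendsto_intSurv hlim fun n => hρ (huM n)⟩
  · refine fun κ hκ => hlow _ μ.continuous_intSurv (fun κ hκ s => ?_) κ hκ
    obtain ⟨n, hn⟩ := hCu κ hκ
    exact ((hmono s).le_of_tendsto (hlim s) n).trans (hn s)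
  · exact ge_of_tendsto' (hlim s) fun n => hν (huM n) s

/-! ### Reflection and the passage to `icv` -/

/-- The image of `μ` under the reflection `x ↦ -x`. -/
noncomputable def reflect (μ : P₁) : P₁ :=
  ⟨μ.meas.map Neg.neg, Measure.isProbabilityMeasure_map measurable_neg.aemeasurable,
    (integrable_map_measure (by fun_prop) measurable_neg.aemeasurable).2 μ.integrable_id.neg⟩

theorem intSurv_reflect (μ : P₁) (s : ℝ) : μ.reflect.intSurv s = -μ.intDist (-s) := by
  change ∫ x, max (x - s) 0 ∂(μ.meas.map Neg.neg) = -∫ x, min (x - -s) 0 ∂μ.meas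
  rw [integral_map measurable_neg.aemeasurable (by fun_prop), ← integral_neg]
  refine integral_congr_ae (ae_of_all _ fun x => ?_)
  simp only
  rw [← max_neg_neg, neg_zero]
  congr 1
  ring

theorem intDist_reflect (μ : P₁) (s : ℝ) : μ.reflect.intDist s = -μ.intSurv (-s) := by
  change ∫ x, min (x - s) 0 ∂(μ.meas.map Neg.neg) = -∫ x, max (x - -s) 0 ∂μ.meas
  rw [integral_map measurable_neg.aemeasurable (by fun_prop), ← integral_neg]
  refine integral_congr_ae (ae_of_all _ fun x => ?_)
  simp only
  rw [← min_neg_neg, neg_zero]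
  congr 1
  ring

theorem mean_reflect (μ : P₁) : μ.reflect.mean = -μ.mean := by
  have h := μ.reflect.mean_sub 0
  rw [intSurv_reflect, intDist_reflect, neg_zero] at h
  linarith [μ.mean_sub 0]

theorem reflect_reflect (μ : P₁) : μ.reflect.reflect = μ :=
  eq_of_intSurv_sub fun s t => by simp [intSurv_reflect, intDist_reflect]

/-- Reflection as an equivalence. -/
noncomputable def reflectEquiv : P₁ ≃ P₁ := ⟨reflect, reflect, reflect_reflect, reflect_reflect⟩

theorem icv_le_iff (μ ν : P₁) : icv.le μ ν ↔ icx.le (reflectEquiv ν) (reflectEquiv μ) := by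
  change (∀ s, μ.intDist s ≤ ν.intDist s) ↔ ∀ s, ν.reflect.intSurv s ≤ μ.reflect.intSurv s
  simp only [intSurv_reflect, neg_le_neg_iff]
  exact ⟨fun h s => h (-s), fun h s => by simpa using h (-s)⟩

theorem icx_le_iff (μ ν : P₁) : icx.le μ ν ↔ icv.le (reflectEquiv ν) (reflectEquiv μ) := by
  rw [icv_le_iff]
  change _ ↔ icx.le μ.reflect.reflect ν.reflect.reflect
  rw [reflect_reflect, reflect_reflect]

theorem tendsto_intSurv_reflect {u : ℕ → P₁} {μ : P₁}
    (hu : ∀ s, Tendsto (fun n => (u n).intSurv s) atTop (𝓝 (μ.intSurv s)))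
    (hmean : Tendsto (fun n => (u n).mean) atTop (𝓝 μ.mean)) :
    TendstoW₁ (fun n => (u n).reflect) μ.reflect := by
  refine tendstoW₁_of_tendsto_intSurv (fun s => ?_) ?_
  · have h : ∀ ν : P₁, ν.reflect.intSurv s = ν.intSurv (-s) - ν.mean - s := fun ν => by
      rw [intSurv_reflect]; linarith [ν.mean_sub (-s)]
    simp only [h]
    exact ((hu (-s)).sub hmean).sub_const s
  · simp only [mean_reflect]
    exact hmean.neg

/-- With `bddAbove_icx_image`, this shows that reflection interchanges the two boundedness
hypotheses, so the pair is self-dual. -/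
theorem bddBelow_icv_image {M : Set P₁} (h : @BddAbove P₁ icx.toLE M) :
    @BddBelow P₁ icv.toLE (reflectEquiv '' M) := by
  obtain ⟨b, hb⟩ := h
  exact ⟨reflectEquiv b, by rintro _ ⟨μ, hμ, rfl⟩; exact (icx_le_iff μ b).1 (hb hμ)⟩

theorem bddAbove_icx_image {M : Set P₁} (h : @BddBelow P₁ icv.toLE M) :
    @BddAbove P₁ icx.toLE (reflectEquiv '' M) := by
  obtain ⟨b, hb⟩ := h
  exact ⟨reflectEquiv b, by rintro _ ⟨μ, hμ, rfl⟩; exact (icv_le_iff b μ).1 (hb hμ)⟩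

end P₁

theorem mainTheorem12 :
    @IsDedekindSuperComplete P₁ P₁.icv ∧ @IsDedekindSuperComplete P₁ P₁.icx ∧
    ∀ M : Set P₁, M.Nonempty → @BddBelow P₁ P₁.icv.toLE M → @BddAbove P₁ P₁.icx.toLE M →
      ∀ o : PartialOrder P₁, o = P₁.icv ∨ o = P₁.icx →
        (DirectedOn (fun μ ν => o.le μ ν) M →
          ∃ (u : ℕ → P₁) (μ : P₁), (∀ n, u n ∈ M) ∧ (∀ n, o.le (u n) (u (n + 1))) ∧
            @IsLUB P₁ o.toLE M μ ∧ P₁.TendstoW₁ u μ) ∧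
        (DirectedOn (fun μ ν => o.le ν μ) M →
          ∃ (u : ℕ → P₁) (μ : P₁), (∀ n, u n ∈ M) ∧ (∀ n, o.le (u (n + 1)) (u n)) ∧
            @IsGLB P₁ o.toLE M μ ∧ P₁.TendstoW₁ u μ) := by
  refine ⟨@IsDedekindSuperComplete.of_antitone_equiv P₁ P₁ P₁.icv P₁.icx P₁.reflectEquiv
    P₁.icv_le_iff P₁.isDedekindSuperComplete_icx, P₁.isDedekindSuperComplete_icx, ?_⟩
  intro M hne hbelow habove o ho
  have hmem : ∀ μ ∈ P₁.reflectEquiv '' M, P₁.reflect μ ∈ M := by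
    rintro _ ⟨μ, hμ, rfl⟩
    exact (P₁.reflect_reflect μ).symm ▸ hμ
  have hle : ∀ μ ν, P₁.icx.le μ ν → P₁.icv.le ν.reflect μ.reflect := fun μ ν =>
    (P₁.icx_le_iff μ ν).1
  rcases ho with rfl | rfl
  · refine ⟨fun hdir => ?_, fun hdir => ?_⟩
    · obtain ⟨u, μ, huM, hu, hμ, hlim, hmean⟩ := P₁.exists_seq_tendsto_isGLB_icx
        (hne.image P₁.reflectEquiv) (P₁.bddBelow_icv_image habove) (P₁.bddAbove_icx_image hbelow) (by
          rintro _ ⟨a, ha, rfl⟩ _ ⟨b, hb, rfl⟩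
          obtain ⟨c, hc, hac, hbc⟩ := hdir a ha b hb
          exact ⟨_, ⟨c, hc, rfl⟩, (P₁.icv_le_iff a c).1 hac, (P₁.icv_le_iff b c).1 hbc⟩)
      refine ⟨fun n => (u n).reflect, μ.reflect, fun n => hmem _ (huM n), fun n => hle _ _ (hu n),
        ?_, P₁.tendsto_intSurv_reflect hlim hmean⟩
      -- Reflection is an involution, so the image of `μ.reflect` is `μ` again.
      rw [@isLUB_iff_isGLB_image P₁ P₁ P₁.icv P₁.icx P₁.reflectEquiv P₁.icv_le_iff]
      exact (P₁.reflectEquiv.apply_symm_apply μ).symm ▸ hμ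
    · obtain ⟨u, μ, huM, hu, hμ, hlim, hmean⟩ := P₁.exists_seq_tendsto_isLUB_icx
        (hne.image P₁.reflectEquiv) (P₁.bddBelow_icv_image habove) (P₁.bddAbove_icx_image hbelow) (by
          rintro _ ⟨a, ha, rfl⟩ _ ⟨b, hb, rfl⟩
          obtain ⟨c, hc, hac, hbc⟩ := hdir a ha b hb
          exact ⟨_, ⟨c, hc, rfl⟩, (P₁.icv_le_iff c a).1 hac, (P₁.icv_le_iff c b).1 hbc⟩)
      refine ⟨fun n => (u n).reflect, μ.reflect, fun n => hmem _ (huM n), fun n => hle _ _ (hu n),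
        ?_, P₁.tendsto_intSurv_reflect hlim hmean⟩
      rw [@isGLB_iff_isLUB_image P₁ P₁ P₁.icv P₁.icx P₁.reflectEquiv P₁.icv_le_iff]
      exact (P₁.reflectEquiv.apply_symm_apply μ).symm ▸ hμ
  · refine ⟨fun hdir => ?_, fun hdir => ?_⟩
    · obtain ⟨u, μ, huM, hu, hμ, hlim, hmean⟩ :=
        P₁.exists_seq_tendsto_isLUB_icx hne hbelow habove hdir
      exact ⟨u, μ, huM, hu, hμ, P₁.tendstoW₁_of_tendsto_intSurv hlim hmean⟩
    · obtain ⟨u, μ, huM, hu, hμ, hlim, hmean⟩ :=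
        P₁.exists_seq_tendsto_isGLB_icx hne hbelow habove hdir
      exact ⟨u, μ, huM, hu, hμ, P₁.tendstoW₁_of_tendsto_intSurv hlim hmean⟩
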